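/- Let $N,K,s\ge 0$ be integers, let $s_1,\dots,s_K$ be integers with $0\le s_k\le s$, put $M=\sum_{k=1}^K s_k$, and let $\delta>0$. Let $V_1,\dots,V_K$ be independent random linear subspaces of $\mathbb R^N$ (measurable with respect to the Borel $\sigma$-algebra of the Grassmannians, a subspace being identified with its orthogonal projection) such that $\dim V_k=s_k$ almost surely and the distribution of each $V_k$ is invariant under unitaries, i.e. $UV_k$ has the same distribution as $V_k$ for every orthogonal map $U$ of $\mathbb R^N$. Let $P_k$ be the orthogonal projection onto $V_k$. Then with probability at least $$1-2\Bigl(1+\frac4\delta\Bigr)^N e^{-M\delta^2/4+M\delta^3/3}-2K\Bigl(1+\frac4\delta\Bigr)^s e^{-N\delta^2/4+N\delta^3/3}$$ the family $\{V_k,1\}_{k=1}^K$ is a fusion frame for $\mathbb R^N$ with lower frame bound $\frac{M}{N(1+\delta)^6}>0$ and upper frame bound $\frac{M(1+\delta)^6}{N}$, that is, $$\frac{M}{N(1+\delta)^6}\|x\|^2\le\sum_{k=1}^K\|P_kx\|^2\le\frac{M(1+\delta)^6}{N}\|x\|^2\qquad\text{for all }x\in\mathbb R^N .$$ In particular, with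 the same probability it is $\epsilon$-nearly $M/N$-tight for $\epsilon=(1+\delta)^6-1$, i.e. it has frame bounds $\frac1{1+\epsilon}C$ and $(1+\epsilon)C$ with $C=M/N$. (If $M=0$ or $N=0$, where the frame bounds are zero or undefined, the asserted lower bound on the probability is negative and nothing is claimed.) -/

import Mathlib

open MeasureTheory ProbabilityTheory

/-- The sigma-algebra on the set of linear subspaces of a finite-dimensional Euclidean space `E`:
a subspace is identified with its orthogonal projection, and the set of orthogonal projections
carries the Borel sigma-algebra of the operator-norm topology. On the subspaces of a fixed dimension
this is the Borel sigma-algebra of the Grassmannian. -/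
noncomputable instance subspaceMeasurableSpace {E : Type*} [NormedAddCommGroup E]
    [InnerProductSpace ℝ E] [FiniteDimensional ℝ E] : MeasurableSpace (Submodule ℝ E) :=
  MeasurableSpace.comap (fun W : Submodule ℝ E => (W.starProjection : E →L[ℝ] E)) inferInstance

/-- A distribution on subspaces is invariant under unitaries: for every linear isometry `U` of `E`
onto itself, the image of the distribution under `W ↦ U W` is the distribution itself. -/
def IsUnitarilyInvariant {E : Type*} [NormedAddCommGroup E]
    [InnerProductSpace ℝ E] [FiniteDimensional ℝ E] (ν : Measure (Submodule ℝ E)) : Prop :=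
  ∀ U : E ≃ₗᵢ[ℝ] E,
    ν.map (fun W : Submodule ℝ E => W.map (U.toLinearEquiv : E →ₗ[ℝ] E)) = ν

/-- `{W i, v i}` is a fusion frame for `E` with lower frame bound `A` and upper frame bound `B`. -/
structure IsFusionFrameWithBounds {ι : Type*} [Fintype ι] {E : Type*} [NormedAddCommGroup E]
    [InnerProductSpace ℝ E] [FiniteDimensional ℝ E]
    (W : ι → Submodule ℝ E) (v : ι → ℝ) (A B : ℝ) : Prop where
  weight_pos : ∀ i, 0 < v i
  lower_pos : 0 < A
  lower_le_upper : A ≤ B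
  lower_bound : ∀ x : E, A * ‖x‖ ^ 2 ≤ ∑ i, v i ^ 2 * ‖(W i).starProjection x‖ ^ 2
  upper_bound : ∀ x : E, ∑ i, v i ^ 2 * ‖(W i).starProjection x‖ ^ 2 ≤ B * ‖x‖ ^ 2

/-- `{W i, v i}` is an `ε`-nearly `C`-tight fusion frame for `E`. -/
def IsNearlyTightFusionFrame {ι : Type*} [Fintype ι] {E : Type*} [NormedAddCommGroup E]
    [InnerProductSpace ℝ E] [FiniteDimensional ℝ E]
    (W : ι → Submodule ℝ E) (v : ι → ℝ) (ε C : ℝ) : Prop :=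
  0 < ε ∧ IsFusionFrameWithBounds W v (1 / (1 + ε) * C) ((1 + ε) * C)

/-! ### Gaussian moment generating functions -/

/-! For a fixed unit vector `x` and a random projection `P` of rank `d` with invariant law, compare
`x` with an independent standard Gaussian `g`. By invariance `‖P g‖²` is distributed as `‖g‖² ‖P
x‖²`, and since `E ‖g‖² = N`, Jensen's inequality in `g` bounds the moment generating function of `N
‖P x‖²` by that of `‖P g‖²`, which is chi-squared with `d` degrees of freedom
(`IsUnitarilyInvariant.integral_exp_le`). By independence, `N ∑ ‖P_k x‖²` is controlled by a
chi-squared variable with `M` degrees of freedom, and Chernoff's bound puts it between `M / (1 + δ)`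
and `M (1 + δ)` up to two tails of size `exp (-M δ² / 4 + M δ³ / 3)`.

A union bound over a `δ / 2`-net of the sphere with at most `(1 + 4 / δ) ^ N` points gives this at
every net point simultaneously (`one_sub_le_measure_forall_mem_net`). Passing to the whole sphere
(`quadratic_bounds_of_net`) costs only second order in the mesh, because extremal vectors of the
form are eigenvectors; the resulting factor is at most `(1 + δ) ^ 3`. The term with `K` and `s` in
the failure probability is therefore not needed and is dropped. -/

lemma integral_exp_mul_sq_gaussianReal {t : ℝ} (ht : t < 1 / 2) :
    ∫ x, Real.exp (t * x ^ 2) ∂(gaussianReal 0 1) = (1 - 2 * t) ^ (-(1 / 2) : ℝ) := by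
  have h0 : 0 < 1 - 2 * t := by linarith
  rw [integral_gaussianReal_eq_integral_smul one_ne_zero]
  have h1 : ∀ x : ℝ, gaussianPDFReal 0 1 x • Real.exp (t * x ^ 2)
      = (√(2 * Real.pi))⁻¹ * Real.exp (-((1 - 2 * t) / 2) * x ^ 2) := by
    intro x
    rw [gaussianPDFReal, smul_eq_mul, mul_assoc, ← Real.exp_add]
    simp only [NNReal.coe_one, mul_one, sub_zero]
    congr 2
    ring
  simp_rw [h1]
  rw [integral_const_mul, integral_gaussian, Real.rpow_neg h0.le, ← Real.sqrt_eq_rpow,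
    ← Real.sqrt_inv, ← Real.sqrt_inv, ← Real.sqrt_mul (by positivity)]
  congr 1
  field_simp

section

variable {E : Type*} [NormedAddCommGroup E] [InnerProductSpace ℝ E] [FiniteDimensional ℝ E]

lemma eigenvalues_starProjection_mem (W : Submodule ℝ E)
    (i : Fin (Module.finrank ℝ E)) :
    W.starProjection_isSymmetric.eigenvalues rfl i = 0 ∨
      W.starProjection_isSymmetric.eigenvalues rfl i = 1 := by
  set hT := W.starProjection_isSymmetric
  have h1 := hT.apply_eigenvectorBasis rfl i
  have h2 : W.starProjection (W.starProjection (hT.eigenvectorBasis rfl i)) =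
      W.starProjection (hT.eigenvectorBasis rfl i) := by
    rw [W.starProjection_eq_self_iff.2 (W.starProjection_apply_mem _)]
  simp only [ContinuousLinearMap.coe_coe] at h1
  rw [h1, map_smul, h1, smul_smul] at h2
  have h3 := smul_left_injective ℝ ((hT.eigenvectorBasis rfl).orthonormal.ne_zero i) h2
  simp only [RCLike.ofReal_real_eq_id, id_eq] at h3
  exact IsIdempotentElem.iff_eq_zero_or_one.1 h3

lemma sum_eigenvalues_starProjection (W : Submodule ℝ E) :
    ∑ i, W.starProjection_isSymmetric.eigenvalues rfl i = Module.finrank ℝ W := by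
  have h := W.starProjection_isSymmetric.trace_eq_sum_eigenvalues rfl
  have h2 : LinearMap.IsProj W (W.starProjection : E →ₗ[ℝ] E) :=
    ⟨fun x => W.starProjection_apply_mem x, fun x hx => W.starProjection_eq_self_iff.2 hx⟩
  rw [h2.trace] at h
  simpa using h.symm

lemma norm_sq_starProjection_sum_eigenvectorBasis (W : Submodule ℝ E)
    (x : Fin (Module.finrank ℝ E) → ℝ) :
    ‖W.starProjection (∑ i, x i • W.starProjection_isSymmetric.eigenvectorBasis rfl i)‖ ^ 2 =
      ∑ i, W.starProjection_isSymmetric.eigenvalues rfl i * x i ^ 2 := by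
  set hT := W.starProjection_isSymmetric
  have h1 : ∀ i, W.starProjection (hT.eigenvectorBasis rfl i) =
      hT.eigenvalues rfl i • hT.eigenvectorBasis rfl i :=
    fun i => hT.apply_eigenvectorBasis rfl i
  simp_rw [map_sum, map_smul, h1, smul_smul]
  rw [← real_inner_self_eq_norm_sq, (hT.eigenvectorBasis rfl).orthonormal.inner_sum]
  refine Finset.sum_congr rfl fun i _ => ?_
  simp only [conj_trivial]
  rcases eigenvalues_starProjection_mem W i with h | h <;> simp only [h] <;> ring

variable [MeasurableSpace E] [BorelSpace E]

/-- In an eigenbasis of the projection the coordinates of `g` are independent standard normals, and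
the eigenvalues 0 and 1 select `finrank W` of their squares. -/
lemma integral_exp_mul_norm_sq_starProjection_stdGaussian (W : Submodule ℝ E) {t : ℝ}
    (ht : t < 1 / 2) :
    ∫ g, Real.exp (t * ‖W.starProjection g‖ ^ 2) ∂(stdGaussian E) =
      (1 - 2 * t) ^ (-((Module.finrank ℝ W : ℝ) / 2)) := by
  have h0 : 0 < 1 - 2 * t := by linarith
  rw [stdGaussian_eq_map_pi_orthonormalBasis (W.starProjection_isSymmetric.eigenvectorBasis rfl),
    integral_map (Measurable.aemeasurable (by fun_prop)) (Continuous.aestronglyMeasurable (by fun_prop))]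
  simp_rw [norm_sq_starProjection_sum_eigenvectorBasis, Finset.mul_sum, Real.exp_sum]
  rw [integral_fintype_prod_eq_prod (μ := fun _ => gaussianReal 0 1)
    (f := fun i x => Real.exp (t * (W.starProjection_isSymmetric.eigenvalues rfl i * x ^ 2)))]
  have h1 : ∀ i, ∫ x, Real.exp (t * (W.starProjection_isSymmetric.eigenvalues rfl i * x ^ 2))
      ∂(gaussianReal 0 1) =
        (1 - 2 * t) ^ (-(1 / 2) * W.starProjection_isSymmetric.eigenvalues rfl i) := by
    intro i
    rcases eigenvalues_starProjection_mem W i with h | h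
    · simp [h]
    · simp only [h, one_mul, mul_one]
      exact integral_exp_mul_sq_gaussianReal ht
  simp_rw [h1]
  rw [← Real.rpow_sum_of_pos h0, ← Finset.mul_sum, sum_eigenvalues_starProjection]
  congr 1
  ring

lemma integrable_exp_mul_norm_sq_stdGaussian {t : ℝ} (ht : t < 1 / 2) :
    Integrable (fun g : E => Real.exp (t * ‖g‖ ^ 2)) (stdGaussian E) := by
  -- A non-integrable function has integral 0 by convention, so a nonzero value of the integral
  -- proves integrability.
  refine not_imp_comm.1 integral_undef ?_
  have h := integral_exp_mul_norm_sq_starProjection_stdGaussian (⊤ : Submodule ℝ E) ht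
  simp only [Submodule.starProjection_top, ContinuousLinearMap.id_apply] at h
  rw [h]
  exact (Real.rpow_pos_of_pos (by linarith) _).ne'

lemma integrable_norm_sq_stdGaussian :
    Integrable (fun g : E => ‖g‖ ^ 2) (stdGaussian E) :=
  (IsGaussian.memLp_two_id (μ := stdGaussian E)).integrable_norm_pow two_ne_zero

lemma integral_norm_sq_stdGaussian :
    ∫ g, ‖g‖ ^ 2 ∂(stdGaussian E) = Module.finrank ℝ E := by
  have hsq : Integrable (fun x : ℝ => x ^ 2) (gaussianReal 0 1) :=
    (IsGaussian.memLp_two_id (μ := gaussianReal 0 1)).integrable_sq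
  have hv : ∫ x, x ^ 2 ∂(gaussianReal 0 1) = 1 := by
    have := variance_id_gaussianReal (μ := 0) (v := 1)
    rw [variance_of_integral_eq_zero (by fun_prop) (by simp)] at this
    simpa using this
  rw [stdGaussian, integral_map (Measurable.aemeasurable (by fun_prop)) (Continuous.aestronglyMeasurable (by fun_prop))]
  have h1 : ∀ x : Fin (Module.finrank ℝ E) → ℝ,
      ‖∑ i, x i • stdOrthonormalBasis ℝ E i‖ ^ 2 = ∑ i, x i ^ 2 := by
    intro x
    rw [← real_inner_self_eq_norm_sq, (stdOrthonormalBasis ℝ E).orthonormal.inner_sum]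
    simp [sq]
  simp_rw [h1]
  rw [integral_finsetSum _ fun i _ => integrable_comp_eval
    (μ := fun _ : Fin (Module.finrank ℝ E) => gaussianReal 0 1) (f := fun x : ℝ => x ^ 2) hsq]
  have h2 : ∀ i : Fin (Module.finrank ℝ E), ∫ x : Fin (Module.finrank ℝ E) → ℝ, x i ^ 2
      ∂(Measure.pi fun _ => gaussianReal 0 1) = 1 := by
    intro i
    rw [integral_comp_eval (μ := fun _ : Fin (Module.finrank ℝ E) => gaussianReal 0 1)
      (f := fun x : ℝ => x ^ 2) hsq.aestronglyMeasurable, hv]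
  simp [h2]

/-- Jensen's inequality, by integrating the tangent line of `exp` at `c`, the mean of `t * (‖g‖ ^ 2
* p)`. The bound `p ≤ 1` keeps `t * p` in the range of integrability. -/
lemma exp_le_integral_exp_stdGaussian {t p : ℝ} (ht : t < 1 / 2) (hp : 0 ≤ p) (hp1 : p ≤ 1) :
    Real.exp (t * (Module.finrank ℝ E * p)) ≤
      ∫ g : E, Real.exp (t * (‖g‖ ^ 2 * p)) ∂(stdGaussian E) := by
  have htp : t * p < 1 / 2 := by
    rcases le_total t 0 with h | h
    · exact (mul_nonpos_of_nonpos_of_nonneg h hp).trans_lt (by norm_num)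
    · exact (mul_le_of_le_one_right h hp1).trans_lt ht
  set c := t * (Module.finrank ℝ E * p)
  have hi : Integrable (fun g : E => Real.exp (t * (‖g‖ ^ 2 * p))) (stdGaussian E) := by
    have := integrable_exp_mul_norm_sq_stdGaussian (E := E) htp
    convert this using 3
    ring
  have hj : Integrable (fun g : E => Real.exp c * (1 - c) + Real.exp c * (t * p) * ‖g‖ ^ 2)
      (stdGaussian E) :=
    (integrable_const _).add (integrable_norm_sq_stdGaussian.const_mul _)
  have h1 : ∫ g : E, (Real.exp c * (1 - c) + Real.exp c * (t * p) * ‖g‖ ^ 2) ∂(stdGaussian E)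
      = Real.exp c := by
    rw [integral_add (integrable_const _) (integrable_norm_sq_stdGaussian.const_mul _),
      integral_const_mul (Real.exp c * (t * p)), integral_norm_sq_stdGaussian]
    simp only [integral_const, probReal_univ, smul_eq_mul, one_mul]
    simp only [c]
    ring
  rw [← h1]
  refine integral_mono hj hi fun g => ?_
  have h2 := Real.add_one_le_exp (t * (‖g‖ ^ 2 * p) - c)
  have h3 : Real.exp (t * (‖g‖ ^ 2 * p)) = Real.exp c * Real.exp (t * (‖g‖ ^ 2 * p) - c) := by
    rw [← Real.exp_add]; congr 1; ring
  calc Real.exp c * (1 - c) + Real.exp c * (t * p) * ‖g‖ ^ 2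
      = Real.exp c * (t * (‖g‖ ^ 2 * p) - c + 1) := by ring
    _ ≤ Real.exp (t * (‖g‖ ^ 2 * p)) := by rw [h3]; gcongr

end

/-! ### Random subspaces with unitarily invariant distribution -/

section

variable {E : Type*} [NormedAddCommGroup E] [InnerProductSpace ℝ E] [FiniteDimensional ℝ E]

lemma norm_sq_starProjection_le (W : Submodule ℝ E) (x : E) :
    ‖W.starProjection x‖ ^ 2 ≤ ‖x‖ ^ 2 := by
  gcongr
  exact W.norm_starProjection_apply_le x

lemma measurable_starProjection :
    Measurable (fun W : Submodule ℝ E => (W.starProjection : E →L[ℝ] E)) :=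
  comap_measurable _

/-- The projection onto `U W` is `U P U⁻¹`, and conjugation is continuous on operators. -/
lemma measurable_map_linearIsometryEquiv (U : E ≃ₗᵢ[ℝ] E) :
    Measurable (fun W : Submodule ℝ E => W.map (U.toLinearEquiv : E →ₗ[ℝ] E)) := by
  rw [measurable_comap_iff]
  let C : (E →L[ℝ] E) → (E →L[ℝ] E) := fun A =>
    (U.toContinuousLinearEquiv : E →L[ℝ] E) ∘L A ∘L (U.symm.toContinuousLinearEquiv : E →L[ℝ] E)
  have hC : Continuous C := by fun_prop
  have h : ((fun W : Submodule ℝ E => (W.starProjection : E →L[ℝ] E)) ∘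
      fun W : Submodule ℝ E => W.map (U.toLinearEquiv : E →ₗ[ℝ] E)) =
      C ∘ fun W : Submodule ℝ E => (W.starProjection : E →L[ℝ] E) := by
    ext W x
    exact Submodule.starProjection_map_apply U W x
  rw [h]
  exact hC.measurable.comp measurable_starProjection

variable [MeasurableSpace E] [BorelSpace E]

lemma measurable_starProjection_apply_uncurry :
    Measurable (fun q : Submodule ℝ E × E => q.1.starProjection q.2) := by
  have h : Measurable (fun q : (E →L[ℝ] E) × E => q.1 q.2) :=
    isBoundedBilinearMap_apply.continuous.measurable
  exact h.comp ((measurable_starProjection.comp measurable_fst).prodMk measurable_snd)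

lemma measurable_starProjection_apply (x : E) :
    Measurable (fun W : Submodule ℝ E => W.starProjection x) :=
  (ContinuousLinearMap.measurable_apply (𝕜 := ℝ) (E := E) (F := E) x).comp
    measurable_starProjection

lemma integrable_exp_prod_stdGaussian (ν : Measure (Submodule ℝ E)) [IsProbabilityMeasure ν]
    {t : ℝ} (ht : t < 1 / 2) {h : Submodule ℝ E → E → ℝ}
    (hm : Measurable (fun q : Submodule ℝ E × E => h q.1 q.2)) (h0 : ∀ W g, 0 ≤ h W g)
    (h1 : ∀ W g, h W g ≤ ‖g‖ ^ 2) :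
    Integrable (fun q : Submodule ℝ E × E => Real.exp (t * h q.1 q.2))
      (ν.prod (stdGaussian E)) := by
  -- The exponent `t` may be negative; `max t 0` gives one dominating function for both signs.
  have hi : Integrable (fun q : Submodule ℝ E × E => Real.exp (max t 0 * ‖q.2‖ ^ 2))
      (ν.prod (stdGaussian E)) :=
    (integrable_exp_mul_norm_sq_stdGaussian (E := E) (max_lt ht (by norm_num))).comp_snd ν
  refine hi.mono' (Real.measurable_exp.comp (hm.const_mul t)).aestronglyMeasurable
    (ae_of_all _ fun q => ?_)
  rw [Real.norm_eq_abs, Real.abs_exp, Real.exp_le_exp]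
  calc t * h q.1 q.2 ≤ max t 0 * h q.1 q.2 :=
        mul_le_mul_of_nonneg_right (le_max_left _ _) (h0 _ _)
    _ ≤ max t 0 * ‖q.2‖ ^ 2 := mul_le_mul_of_nonneg_left (h1 _ _) (le_max_right _ _)

lemma IsUnitarilyInvariant.integral_norm_sq_starProjection_eq {ν : Measure (Submodule ℝ E)}
    (hν : IsUnitarilyInvariant ν) (F : ℝ → ℝ) (hF : Measurable F) {x y : E} (hxy : ‖x‖ = ‖y‖) :
    ∫ W, F (‖W.starProjection x‖ ^ 2) ∂ν = ∫ W, F (‖W.starProjection y‖ ^ 2) ∂ν := by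
  -- The reflection in the hyperplane orthogonal to `x - y` exchanges two vectors of equal norm.
  set U : E ≃ₗᵢ[ℝ] E := (ℝ ∙ (x - y))ᗮ.reflection
  have hU : U x = y := Submodule.reflection_sub hxy
  have hm : Measurable (fun W : Submodule ℝ E => F (‖W.starProjection y‖ ^ 2)) :=
    hF.comp ((measurable_starProjection_apply y).norm.pow_const 2)
  conv_rhs => rw [← hν U]
  rw [integral_map (measurable_map_linearIsometryEquiv U).aemeasurable hm.aestronglyMeasurable]
  congr 1
  ext W
  rw [Submodule.starProjection_map_apply, ← hU, U.symm_apply_apply, U.norm_map]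

/-- The moment generating function of `dim E * ‖P x‖ ^ 2`, for a random projection `P` of rank `d`,
is at most that of a chi-squared variable with `d` degrees of freedom. -/
lemma IsUnitarilyInvariant.integral_exp_le {ν : Measure (Submodule ℝ E)} [IsProbabilityMeasure ν]
    (hν : IsUnitarilyInvariant ν) {d : ℕ} (hd : ∀ᵐ W : Submodule ℝ E ∂ν, Module.finrank ℝ W = d)
    {x : E} (hx : ‖x‖ = 1) {t : ℝ} (ht : t < 1 / 2) :
    ∫ W, Real.exp (t * (Module.finrank ℝ E * ‖W.starProjection x‖ ^ 2)) ∂ν ≤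
      (1 - 2 * t) ^ (-((d : ℝ) / 2)) := by
  have hp0 : ∀ W : Submodule ℝ E, 0 ≤ ‖W.starProjection x‖ ^ 2 := fun W => by positivity
  have hp1 : ∀ W : Submodule ℝ E, ‖W.starProjection x‖ ^ 2 ≤ 1 := fun W => by
    simpa [hx] using norm_sq_starProjection_le W x
  have hmeas : Measurable (fun q : Submodule ℝ E × E => ‖q.2‖ ^ 2 * ‖q.1.starProjection x‖ ^ 2) :=
    (measurable_snd.norm.pow_const 2).mul
      (((measurable_starProjection_apply x).comp measurable_fst).norm.pow_const 2)
  have hle : ∀ (W : Submodule ℝ E) (g : E), ‖g‖ ^ 2 * ‖W.starProjection x‖ ^ 2 ≤ ‖g‖ ^ 2 :=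
    fun W g => mul_le_of_le_one_right (by positivity) (hp1 W)
  have hint := integrable_exp_prod_stdGaussian ν ht hmeas (fun W g => by positivity) hle
  have hint' := integrable_exp_prod_stdGaussian ν ht
    (measurable_starProjection_apply_uncurry.norm.pow_const 2) (fun W g => by positivity)
    norm_sq_starProjection_le
  calc ∫ W, Real.exp (t * (Module.finrank ℝ E * ‖W.starProjection x‖ ^ 2)) ∂ν
      ≤ ∫ W, ∫ g, Real.exp (t * (‖g‖ ^ 2 * ‖W.starProjection x‖ ^ 2)) ∂(stdGaussian E) ∂ν := by
        refine integral_mono_of_nonneg (ae_of_all _ fun W => (Real.exp_pos _).le)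
          hint.integral_prod_left (ae_of_all _ fun W => ?_)
        exact exp_le_integral_exp_stdGaussian ht (hp0 W) (hp1 W)
    _ = ∫ g, ∫ W, Real.exp (t * (‖g‖ ^ 2 * ‖W.starProjection x‖ ^ 2)) ∂ν ∂(stdGaussian E) :=
        integral_integral_swap hint
    _ = ∫ g, ∫ W, Real.exp (t * ‖W.starProjection g‖ ^ 2) ∂ν ∂(stdGaussian E) := by
        congr 1
        ext g
        -- For fixed `g`, the vectors `‖g‖ • x` and `g` have the same norm, so invariance exchanges
        -- them.
        rw [← hν.integral_norm_sq_starProjection_eq (fun r => Real.exp (t * r)) (by fun_prop)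
          (x := ‖g‖ • x) (y := g) (by simp [norm_smul, hx])]
        simp only [map_smul, norm_smul, norm_norm, mul_pow]
    _ = ∫ W, ∫ g, Real.exp (t * ‖W.starProjection g‖ ^ 2) ∂(stdGaussian E) ∂ν :=
        (integral_integral_swap hint').symm
    _ = ∫ W, (1 - 2 * t) ^ (-((d : ℝ) / 2)) ∂ν := by
        refine integral_congr_ae ?_
        filter_upwards [hd] with W hW
        rw [integral_exp_mul_norm_sq_starProjection_stdGaussian W ht, hW]
    _ = (1 - 2 * t) ^ (-((d : ℝ) / 2)) := by simp

end

/-! ### Nets of the unit sphere -/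

section

variable {E : Type*} [NormedAddCommGroup E] [InnerProductSpace ℝ E] [FiniteDimensional ℝ E]

/-- Volume comparison: the balls of radius `r / 2` about the points are disjoint and lie in the ball
of radius `1 + r / 2`. -/
lemma card_le_of_separated_unit {r : ℝ} (hr : 0 < r) (c : Finset E) (hc : ∀ x ∈ c, ‖x‖ = 1)
    (hsep : ∀ x ∈ c, ∀ y ∈ c, x ≠ y → r ≤ ‖x - y‖) :
    (c.card : ℝ) ≤ (1 + 2 / r) ^ Module.finrank ℝ E := by
  borelize E
  let μ : Measure E := Measure.addHaar
  have hr2 : 0 < r / 2 := by positivity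
  have hρ : 0 < 1 + r / 2 := by positivity
  have hdisj : Set.PairwiseDisjoint (↑c : Set E) fun x => Metric.ball x (r / 2) := by
    intro x hx y hy hxy
    refine Metric.ball_disjoint_ball ?_
    rw [dist_eq_norm]
    linarith [hsep x hx y hy hxy]
  have hsub : (⋃ x ∈ c, Metric.ball x (r / 2)) ⊆ Metric.ball (0 : E) (1 + r / 2) := by
    refine Set.iUnion₂_subset fun x hx => Metric.ball_subset_ball' ?_
    rw [dist_zero_right, hc x hx, add_comm]
  have h1 : (c.card : ENNReal) * ENNReal.ofReal ((r / 2) ^ Module.finrank ℝ E) *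
      μ (Metric.ball 0 1) ≤
        ENNReal.ofReal ((1 + r / 2) ^ Module.finrank ℝ E) * μ (Metric.ball 0 1) := by
    rw [← μ.addHaar_ball_of_pos _ hρ]
    refine le_trans (le_of_eq ?_) (measure_mono hsub)
    rw [measure_biUnion_finset hdisj fun c _ => measurableSet_ball]
    simp only [μ.addHaar_ball_of_pos _ hr2, Finset.sum_const, nsmul_eq_mul, mul_assoc]
  have h2 := (ENNReal.mul_le_mul_iff_left (Metric.measure_ball_pos _ _ zero_lt_one).ne'
    measure_ball_lt_top.ne).1 h1
  have h3 := ENNReal.toReal_le_of_le_ofReal (by positivity) h2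
  rw [ENNReal.toReal_mul, ENNReal.toReal_natCast, ENNReal.toReal_ofReal (by positivity)] at h3
  have h4 : 1 + 2 / r = (1 + r / 2) / (r / 2) := by field_simp; ring
  rw [h4, div_pow, le_div_iff₀ (by positivity)]
  exact h3

/-- A separated set of maximal cardinality is a net: a point far from all of it could be added. The
packing bound guarantees that a maximum exists. -/
lemma exists_unit_net {r : ℝ} (hr : 0 < r) :
    ∃ c : Finset E, (∀ x ∈ c, ‖x‖ = 1) ∧
      (c.card : ℝ) ≤ (1 + 2 / r) ^ Module.finrank ℝ E ∧
        ∀ x : E, ‖x‖ = 1 → ∃ y ∈ c, ‖y - x‖ ≤ r := by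
  classical
  let S : Set ℕ := {n | ∃ c : Finset E, c.card = n ∧ (∀ x ∈ c, ‖x‖ = 1) ∧
    ∀ x ∈ c, ∀ y ∈ c, x ≠ y → r ≤ ‖x - y‖}
  have hbdd : BddAbove S := by
    refine ⟨⌊(1 + 2 / r) ^ Module.finrank ℝ E⌋₊, ?_⟩
    rintro _ ⟨c, rfl, h1, h2⟩
    exact Nat.le_floor (card_le_of_separated_unit hr c h1 h2)
  obtain ⟨c, hcard, h1, h2⟩ : sSup S ∈ S := Nat.sSup_mem ⟨0, ∅, by simp⟩ hbdd
  refine ⟨c, h1, card_le_of_separated_unit hr c h1 h2, fun x hx => ?_⟩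
  by_contra! hfar
  have hxc : x ∉ c := fun h => by simpa using (hr.trans (hfar x h))
  have hmem : c.card + 1 ∈ S := by
    refine ⟨insert x c, Finset.card_insert_of_notMem hxc, ?_, ?_⟩
    · simpa [hx] using h1
    · intro y hy z hz hyz
      rw [Finset.mem_insert] at hy hz
      rcases hy with rfl | hy <;> rcases hz with rfl | hz
      · exact absurd rfl hyz
      · rw [norm_sub_rev]; exact (hfar z hz).le
      · exact (hfar y hy).le
      · exact h2 y hy z hz hyz
  have := le_csSup hbdd hmem
  omega

/-! ### Quadratic forms on nets -/

/-- The symmetric operator `T - a` kills `x`, so its quadratic form is unchanged by translation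
along `x`. This makes the net error quadratic in the mesh. -/
lemma inner_sub_eigenvector {F : Type*} [NormedAddCommGroup F] [InnerProductSpace ℝ F]
    {T : F →L[ℝ] F} (hT : (T : F →ₗ[ℝ] F).IsSymmetric) {x : F} {a : ℝ}
    (hx : T x = a • x) (y : F) :
    inner ℝ (T y) y - a * ‖y‖ ^ 2 = inner ℝ (T (y - x)) (y - x) - a * ‖y - x‖ ^ 2 := by
  have h1 : inner ℝ (T y) x = a * inner ℝ y x := by
    have := hT y x
    simp only [ContinuousLinearMap.coe_coe] at this
    rw [this, hx, real_inner_smul_right]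
  rw [← real_inner_self_eq_norm_sq, ← real_inner_self_eq_norm_sq]
  simp only [map_sub, inner_sub_left, inner_sub_right, h1, hx, real_inner_smul_left,
    real_inner_comm x y]
  ring

/-- The quadratic form attains its extrema on the compact sphere, and extremal points of the
Rayleigh quotient are eigenvectors. -/
lemma exists_extremal_eigenvectors [Nontrivial E] {T : E →L[ℝ] E}
    (hT : (T : E →ₗ[ℝ] E).IsSymmetric) :
    ∃ (x y : E) (a b : ℝ), ‖x‖ = 1 ∧ ‖y‖ = 1 ∧ T x = a • x ∧ T y = b • y ∧
      ∀ z, a * ‖z‖ ^ 2 ≤ inner ℝ (T z) z ∧ inner ℝ (T z) z ≤ b * ‖z‖ ^ 2 := by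
  have hT' : IsSelfAdjoint T := ContinuousLinearMap.isSelfAdjoint_iff_isSymmetric.2 hT
  have hcomp : IsCompact (Metric.sphere (0 : E) 1) := isCompact_sphere _ _
  have hne : (Metric.sphere (0 : E) 1).Nonempty := NormedSpace.sphere_nonempty.2 zero_le_one
  have hcont : ContinuousOn T.reApplyInnerSelf (Metric.sphere (0 : E) 1) :=
    T.reApplyInnerSelf_continuous.continuousOn
  obtain ⟨x, hx, hxmin⟩ := hcomp.exists_isMinOn hne hcont
  obtain ⟨y, hy, hymax⟩ := hcomp.exists_isMaxOn hne hcont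
  rw [mem_sphere_zero_iff_norm] at hx hy
  have hxe := hT'.eq_smul_self_of_isLocalExtrOn (x₀ := x) (Or.inl (hx ▸ hxmin.localize))
  have hye := hT'.eq_smul_self_of_isLocalExtrOn (x₀ := y) (Or.inr (hy ▸ hymax.localize))
  have hq : ∀ w, ‖w‖ = 1 → T.rayleighQuotient w = inner ℝ (T w) w := fun w hw => by
    simp [ContinuousLinearMap.rayleighQuotient, ContinuousLinearMap.reApplyInnerSelf_apply, hw]
  refine ⟨x, y, inner ℝ (T x) x, inner ℝ (T y) y, hx, hy, ?_, ?_, fun z => ?_⟩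
  · simpa [hq x hx] using hxe
  · simpa [hq y hy] using hye
  · rcases eq_or_ne z 0 with rfl | hz
    · simp
    have hz' : 0 < ‖z‖ := norm_pos_iff.2 hz
    have hw : ‖‖z‖⁻¹ • z‖ = 1 := by rw [norm_smul, norm_inv, norm_norm, inv_mul_cancel₀ hz'.ne']
    have h1 := hxmin (mem_sphere_zero_iff_norm.2 hw)
    have h2 := hymax (mem_sphere_zero_iff_norm.2 hw)
    simp only [Set.mem_ofPred_eq, ContinuousLinearMap.reApplyInnerSelf_apply, RCLike.re_to_real,
      map_smul, real_inner_smul_left, real_inner_smul_right] at h1 h2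
    have h3 : inner ℝ (T z) z = ‖z‖⁻¹ * (‖z‖⁻¹ * inner ℝ (T z) z) * ‖z‖ ^ 2 := by
      field_simp
    constructor
    · rw [h3]; gcongr
    · rw [h3]; gcongr

/-- If a positive quadratic form takes values in `[α, β]` on an `ε`-net of the unit sphere, then
its upper bound increases by a factor of at most `(1 - ε ^ 2)⁻¹` and its lower bound decreases by
at most `ε ^ 2` times the new upper bound on the whole sphere. -/
lemma quadratic_bounds_of_net {T : E →L[ℝ] E}
    (hT : (T : E →ₗ[ℝ] E).IsSymmetric) (hpos : ∀ x, 0 ≤ inner ℝ (T x) x) {c : Finset E}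
    (hc : ∀ x ∈ c, ‖x‖ = 1) {ε α β : ℝ} (hε0 : 0 ≤ ε) (hε1 : ε < 1)
    (hnet : ∀ x : E, ‖x‖ = 1 → ∃ y ∈ c, ‖y - x‖ ≤ ε)
    (hα : ∀ y ∈ c, α ≤ inner ℝ (T y) y) (hβ : ∀ y ∈ c, inner ℝ (T y) y ≤ β) (z : E) :
    (α - ε ^ 2 * (β / (1 - ε ^ 2))) * ‖z‖ ^ 2 ≤ inner ℝ (T z) z ∧
      inner ℝ (T z) z ≤ β / (1 - ε ^ 2) * ‖z‖ ^ 2 := by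
  rcases subsingleton_or_nontrivial E with hE | hE
  · simp [Subsingleton.elim z 0]
  obtain ⟨x, y, a, b, hx, hy, hTx, hTy, hab⟩ := exists_extremal_eigenvectors hT
  have hε2 : 0 < 1 - ε ^ 2 := by nlinarith
  have ha : 0 ≤ a := by
    have := hpos x
    rwa [hTx, real_inner_smul_left, real_inner_self_eq_norm_sq, hx, one_pow, mul_one] at this
  have hb : 0 ≤ b := by
    have := hpos y
    rwa [hTy, real_inner_smul_left, real_inner_self_eq_norm_sq, hy, one_pow, mul_one] at this
  have hbβ : b ≤ β / (1 - ε ^ 2) := by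
    rw [le_div_iff₀ hε2]
    obtain ⟨w, hw, hwy⟩ := hnet y hy
    have h1 := inner_sub_eigenvector hT hTy w
    have h2 : ‖w - y‖ ^ 2 ≤ ε ^ 2 := by gcongr
    rw [hc w hw] at h1
    -- Dropping the nonnegative form at `w - y` leaves `b (1 - ε²) ≤ β`.
    nlinarith [hβ w hw, hpos (w - y), mul_le_mul_of_nonneg_left h2 hb]
  have haα : α - ε ^ 2 * (β / (1 - ε ^ 2)) ≤ a := by
    obtain ⟨w, hw, hwx⟩ := hnet x hx
    have h1 := inner_sub_eigenvector hT hTx w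
    have h2 : ‖w - x‖ ^ 2 ≤ ε ^ 2 := by gcongr
    rw [hc w hw] at h1
    have h3 : inner ℝ (T (w - x)) (w - x) ≤ ε ^ 2 * (β / (1 - ε ^ 2)) :=
      calc inner ℝ (T (w - x)) (w - x) ≤ b * ‖w - x‖ ^ 2 := (hab _).2
        _ ≤ (β / (1 - ε ^ 2)) * ε ^ 2 := mul_le_mul hbβ h2 (by positivity) (hb.trans hbβ)
        _ = _ := mul_comm _ _
    -- Here `a` is the form at `w`, minus the form at `w - x`, plus the nonnegative `a ‖w - x‖²`.
    nlinarith [hα w hw, mul_nonneg ha (sq_nonneg ‖w - x‖)]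
  exact ⟨(by gcongr : _ ≤ a * ‖z‖ ^ 2).trans (hab z).1, (hab z).2.trans (by gcongr)⟩

end

/-! ### Elementary inequalities -/

/-- For the upper tail: multiplied by `M / 2`, it turns the Chernoff exponent into `-M δ² / 4 + M δ³
/ 3`. The difference of the two sides vanishes at 0 and is monotone. -/
lemma log_one_add_le_cubic {x : ℝ} (hx : 0 ≤ x) :
    Real.log (1 + x) ≤ x - x ^ 2 / 2 + 2 * x ^ 3 / 3 := by
  let f : ℝ → ℝ := fun y => y - y ^ 2 / 2 + 2 * y ^ 3 / 3 - Real.log (1 + y)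
  have hd : ∀ y, 0 ≤ y → HasDerivAt f (1 - y + 2 * y ^ 2 - 1 / (1 + y)) y := by
    intro y hy
    have h1 := ((hasDerivAt_id y).const_add 1).log (by simp; positivity)
    have h2 := (((hasDerivAt_id y).sub ((hasDerivAt_pow 2 y).div_const 2)).add
      (((hasDerivAt_pow 3 y).const_mul 2).div_const 3)).sub h1
    convert! h2 using 1
    simp; ring
  have hmono : MonotoneOn f (Set.Ici 0) := by
    refine monotoneOn_of_hasDerivWithinAt_nonneg (convex_Ici 0)
      (fun y hy => (hd y hy).continuousAt.continuousWithinAt)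
      (fun y hy => (hd y (interior_subset hy)).hasDerivWithinAt) fun y hy => ?_
    have hy0 : 0 ≤ y := interior_subset hy
    have : 1 - y + 2 * y ^ 2 - 1 / (1 + y) = (y ^ 2 + 2 * y ^ 3) / (1 + y) := by
      field_simp; ring
    rw [this]
    positivity
  have := hmono (Set.mem_Ici.2 le_rfl) (Set.mem_Ici.2 hx) hx
  simp only [f] at this
  norm_num at this
  linarith

/-- The counterpart for the lower tail, proved in the same way; the term `x / (1 + x)` comes from
the threshold `M / (1 + δ)`. -/
lemma le_log_one_add_cubic {x : ℝ} (hx : 0 ≤ x) :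
    x / (1 + x) + x ^ 2 / 2 - 2 * x ^ 3 / 3 ≤ Real.log (1 + x) := by
  let f : ℝ → ℝ := fun y => Real.log (1 + y) - (1 - (1 + y)⁻¹) - y ^ 2 / 2 + 2 * y ^ 3 / 3
  have hd : ∀ y, 0 ≤ y →
      HasDerivAt f (1 / (1 + y) - 1 / (1 + y) ^ 2 - y + 2 * y ^ 2) y := by
    intro y hy
    have h0 : 1 + id y ≠ 0 := by simp; positivity
    have h1 := ((hasDerivAt_id y).const_add 1).log h0
    have h2 := ((((hasDerivAt_id y).const_add 1).inv h0).const_sub 1)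
    have h3 := ((h1.sub h2).sub ((hasDerivAt_pow 2 y).div_const 2)).add
      (((hasDerivAt_pow 3 y).const_mul 2).div_const 3)
    convert! h3 using 1
    simp; ring
  have hmono : MonotoneOn f (Set.Ici 0) := by
    refine monotoneOn_of_hasDerivWithinAt_nonneg (convex_Ici 0)
      (fun y hy => (hd y hy).continuousAt.continuousWithinAt)
      (fun y hy => (hd y (interior_subset hy)).hasDerivWithinAt) fun y hy => ?_
    have hy0 : 0 ≤ y := interior_subset hy
    have : 1 / (1 + y) - 1 / (1 + y) ^ 2 - y + 2 * y ^ 2 =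
        y ^ 3 * (3 + 2 * y) / (1 + y) ^ 2 := by
      field_simp; ring
    rw [this]
    positivity
  have := hmono (Set.mem_Ici.2 le_rfl) (Set.mem_Ici.2 hx) hx
  simp only [f] at this
  norm_num at this
  have h4 : x / (1 + x) = 1 - (1 + x)⁻¹ := by field_simp; ring
  linarith

lemma net_upper_bound_le {δ : ℝ} (h0 : 0 < δ) (h1 : δ < 3 / 4) :
    (1 + δ) / (1 - (δ / 2) ^ 2) ≤ (1 + δ) ^ 3 := by
  have h2 : 0 < 1 - (δ / 2) ^ 2 := by nlinarith
  rw [div_le_iff₀ h2]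
  have : 1 ≤ (1 + δ) ^ 2 * (1 - (δ / 2) ^ 2) := by
    nlinarith [mul_pos h0 h0, mul_pos h0 (mul_pos h0 h0), mul_pos (mul_pos h0 h0) (mul_pos h0 h0)]
  nlinarith

lemma le_net_lower_bound {δ : ℝ} (h0 : 0 < δ) (h1 : δ < 3 / 4) :
    1 / (1 + δ) ^ 3 ≤ 1 / (1 + δ) - (δ / 2) ^ 2 * ((1 + δ) / (1 - (δ / 2) ^ 2)) := by
  have h2 : 0 < 1 - (δ / 2) ^ 2 := by nlinarith
  have h3 : 1 / (1 + δ) - (δ / 2) ^ 2 * ((1 + δ) / (1 - (δ / 2) ^ 2)) - 1 / (1 + δ) ^ 3 =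
      δ * ((2 + δ) * (1 - (δ / 2) ^ 2) - δ / 4 * (1 + δ) ^ 4) /
        ((1 + δ) ^ 3 * (1 - (δ / 2) ^ 2)) := by
    generalize 1 - (δ / 2) ^ 2 = u at h2
    field_simp; ring
  -- Crude bounds at `δ = 3 / 4` suffice for the bracket.
  have h4 : 0 ≤ (2 + δ) * (1 - (δ / 2) ^ 2) - δ / 4 * (1 + δ) ^ 4 := by
    have h5 : (1 + δ) ^ 4 ≤ (7 / 4) ^ 4 := pow_le_pow_left₀ (by positivity) (by linarith) _
    have h6 : (δ / 2) ^ 2 ≤ (3 / 8) ^ 2 := pow_le_pow_left₀ (by positivity) (by linarith) _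
    have h7 : δ / 4 * (1 + δ) ^ 4 ≤ δ / 4 * (7 / 4) ^ 4 := by gcongr
    nlinarith
  rw [← sub_nonneg, h3]
  positivity

/-! ### Concentration for sums of independent random projections -/

section

variable {E : Type*} [NormedAddCommGroup E] [InnerProductSpace ℝ E] [FiniteDimensional ℝ E]

lemma inner_sum_starProjection {ι : Type*} [Fintype ι] (W : ι → Submodule ℝ E) (x : E) :
    inner ℝ ((∑ i, (W i).starProjection) x) x = ∑ i, ‖(W i).starProjection x‖ ^ 2 := by
  rw [sum_apply, sum_inner]
  refine Finset.sum_congr rfl fun i _ => ?_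
  rw [← real_inner_self_eq_norm_sq, (W i).inner_starProjection_left_eq_right,
    (W i).inner_starProjection_left_eq_right,
    (W i).starProjection_eq_self_iff.2 ((W i).starProjection_apply_mem x)]

lemma isSymmetric_sum_starProjection {ι : Type*} [Fintype ι] (W : ι → Submodule ℝ E) :
    ((∑ i, (W i).starProjection : E →L[ℝ] E) : E →ₗ[ℝ] E).IsSymmetric := by
  intro x y
  simp only [ContinuousLinearMap.coe_coe, sum_apply, sum_inner, inner_sum]
  exact Finset.sum_congr rfl fun i _ => (W i).inner_starProjection_left_eq_right x y

/-- The dimension is the trace of the projection. Measurability transfers the almost sure dimension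
from `Ω` to the law of `V`. -/
lemma measurableSet_finrank_eq (d : ℕ) :
    MeasurableSet {W : Submodule ℝ E | Module.finrank ℝ W = d} := by
  let f : (E →L[ℝ] E) →ₗ[ℝ] ℝ := LinearMap.trace ℝ E ∘ₗ ContinuousLinearMap.coeLM ℝ
  have hf : Measurable f := f.continuous_of_finiteDimensional.measurable
  have h : ∀ W : Submodule ℝ E, f W.starProjection = Module.finrank ℝ W := fun W =>
    LinearMap.IsProj.trace (p := W) (f := (W.starProjection : E →ₗ[ℝ] E))
      ⟨W.starProjection_apply_mem, fun _ => W.starProjection_eq_self_iff.2⟩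
  have : {W : Submodule ℝ E | Module.finrank ℝ W = d} =
      (fun W : Submodule ℝ E => f W.starProjection) ⁻¹' {(d : ℝ)} := by
    ext W
    simp [h]
  rw [this]
  exact (hf.comp measurable_starProjection) (measurableSet_singleton _)

variable [MeasurableSpace E] [BorelSpace E]

variable {Ω : Type*} [MeasurableSpace Ω] {μ : Measure Ω} [IsProbabilityMeasure μ]
  {ι : Type*} [Fintype ι] {V : ι → Ω → Submodule ℝ E} {d : ι → ℕ}

lemma mgf_norm_sq_starProjection_le {V : Ω → Submodule ℝ E} {d : ℕ} (hV : Measurable V)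
    (hd : ∀ᵐ ω ∂μ, Module.finrank ℝ (V ω) = d) (hinv : IsUnitarilyInvariant (μ.map V))
    {x : E} (hx : ‖x‖ = 1) {t : ℝ} (ht : t < 1 / 2) :
    mgf (fun ω => Module.finrank ℝ E * ‖(V ω).starProjection x‖ ^ 2) μ t ≤
      (1 - 2 * t) ^ (-((d : ℝ) / 2)) := by
  have : IsProbabilityMeasure (μ.map V) := Measure.isProbabilityMeasure_map hV.aemeasurable
  have hm : Measurable fun W : Submodule ℝ E =>
      Real.exp (t * (Module.finrank ℝ E * ‖W.starProjection x‖ ^ 2)) :=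
    Real.measurable_exp.comp
      ((((measurable_starProjection_apply x).norm.pow_const 2).const_mul _).const_mul t)
  have h := hinv.integral_exp_le
    ((ae_map_iff hV.aemeasurable (measurableSet_finrank_eq d)).2 hd) hx ht
  rwa [integral_map hV.aemeasurable hm.aestronglyMeasurable] at h

lemma mgf_sum_norm_sq_starProjection_le (hV : ∀ i, Measurable (V i))
    (hd : ∀ i, ∀ᵐ ω ∂μ, Module.finrank ℝ (V i ω) = d i) (hind : iIndepFun V μ)
    (hinv : ∀ i, IsUnitarilyInvariant (μ.map (V i)))
    {x : E} (hx : ‖x‖ = 1) {t : ℝ} (ht : t < 1 / 2) :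
    mgf (∑ i, fun ω => Module.finrank ℝ E * ‖(V i ω).starProjection x‖ ^ 2) μ t ≤
      (1 - 2 * t) ^ (-(((∑ i, d i : ℕ) : ℝ) / 2)) := by
  have hm : Measurable fun W : Submodule ℝ E =>
      (Module.finrank ℝ E : ℝ) * ‖W.starProjection x‖ ^ 2 :=
    ((measurable_starProjection_apply x).norm.pow_const 2).const_mul _
  have hind' : iIndepFun
      (fun i ω => (Module.finrank ℝ E : ℝ) * ‖(V i ω).starProjection x‖ ^ 2) μ :=
    hind.comp _ fun _ => hm
  rw [hind'.mgf_sum fun i => hm.comp (hV i)]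
  calc _ ≤ ∏ i, (1 - 2 * t) ^ (-((d i : ℝ) / 2)) :=
        Finset.prod_le_prod (fun _ _ => mgf_nonneg) fun i _ =>
          mgf_norm_sq_starProjection_le (hV i) (hd i) (hinv i) hx ht
    _ = _ := by
        rw [← Real.rpow_sum_of_pos (by linarith), Finset.sum_neg_distrib, ← Finset.sum_div]
        push_cast
        rfl

lemma integrable_exp_mul_sum_norm_sq (hV : ∀ i, Measurable (V i)) (x : E) (t : ℝ) :
    Integrable (fun ω => Real.exp (t *
      (∑ i, fun ω => (Module.finrank ℝ E : ℝ) * ‖(V i ω).starProjection x‖ ^ 2) ω)) μ := by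
  have hm : Measurable
      (∑ i, fun ω => (Module.finrank ℝ E : ℝ) * ‖(V i ω).starProjection x‖ ^ 2) := by
    refine Finset.sum_induction _ _ (fun _ _ => Measurable.add) measurable_const fun i _ => ?_
    exact (((measurable_starProjection_apply x).comp (hV i)).norm.pow_const 2).const_mul _
  refine Integrable.of_bound (Real.measurable_exp.comp (hm.const_mul t)).aestronglyMeasurable
    (Real.exp (|t| * ∑ _i : ι, (Module.finrank ℝ E : ℝ) * ‖x‖ ^ 2)) (ae_of_all _ fun ω => ?_)
  rw [Real.norm_eq_abs, Real.abs_exp, Real.exp_le_exp, Finset.sum_apply]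
  refine (mul_le_mul_of_nonneg_right (le_abs_self t) (by positivity)).trans ?_
  gcongr with i
  exact (V i ω).norm_starProjection_apply_le x

lemma measure_le_sum_norm_sq_starProjection (hV : ∀ i, Measurable (V i))
    (hd : ∀ i, ∀ᵐ ω ∂μ, Module.finrank ℝ (V i ω) = d i) (hind : iIndepFun V μ)
    (hinv : ∀ i, IsUnitarilyInvariant (μ.map (V i)))
    {x : E} (hx : ‖x‖ = 1) {M : ℕ} (hM : M = ∑ i, d i) {δ : ℝ} (hδ : 0 < δ) :
    μ.real {ω | M * (1 + δ) ≤ Module.finrank ℝ E * ∑ i, ‖(V i ω).starProjection x‖ ^ 2} ≤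
      Real.exp (-(M * δ ^ 2 / 4) + M * δ ^ 3 / 3) := by
  have h1δ : 0 < 1 + δ := by linarith
  -- The minimizer of the Chernoff exponent `-t M (1 + δ) - (M / 2) log (1 - 2 t)`.
  set t := δ / (2 * (1 + δ))
  have ht : 1 - 2 * t = (1 + δ)⁻¹ := by simp only [t]; field_simp; ring
  have ht2 : t < 1 / 2 := by linarith [inv_pos.2 h1δ]
  have h := (measure_ge_le_exp_mul_mgf (μ := μ) (M * (1 + δ)) (show 0 ≤ t by positivity)
    (integrable_exp_mul_sum_norm_sq hV x t)).trans (mul_le_mul_of_nonneg_left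
      (mgf_sum_norm_sq_starProjection_le hV hd hind hinv hx ht2) (Real.exp_pos _).le)
  simp only [Finset.sum_apply, ← Finset.mul_sum] at h
  refine h.trans ?_
  rw [ht, ← hM, Real.rpow_def_of_pos (inv_pos.2 h1δ), Real.log_inv, ← Real.exp_add,
    Real.exp_le_exp]
  have h2 : -t * (M * (1 + δ)) = -(M * (δ / 2)) := by simp only [t]; field_simp
  rw [h2]
  have h3 := mul_le_mul_of_nonneg_left (log_one_add_le_cubic hδ.le) (Nat.cast_nonneg (α := ℝ) M)
  linarith

lemma measure_sum_norm_sq_starProjection_le (hV : ∀ i, Measurable (V i))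
    (hd : ∀ i, ∀ᵐ ω ∂μ, Module.finrank ℝ (V i ω) = d i) (hind : iIndepFun V μ)
    (hinv : ∀ i, IsUnitarilyInvariant (μ.map (V i)))
    {x : E} (hx : ‖x‖ = 1) {M : ℕ} (hM : M = ∑ i, d i) {δ : ℝ} (hδ : 0 < δ) :
    μ.real {ω | Module.finrank ℝ E * ∑ i, ‖(V i ω).starProjection x‖ ^ 2 ≤ M / (1 + δ)} ≤
      Real.exp (-(M * δ ^ 2 / 4) + M * δ ^ 3 / 3) := by
  have h1δ : 0 < 1 + δ := by linarith
  -- The optimal parameter for the threshold `M / (1 + δ)` is `t = -δ / 2`.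
  have ht : 1 - 2 * (-(δ / 2)) = 1 + δ := by ring
  have h := (measure_le_le_exp_mul_mgf (μ := μ) (M / (1 + δ)) (show -(δ / 2) ≤ 0 by linarith)
    (integrable_exp_mul_sum_norm_sq hV x _)).trans (mul_le_mul_of_nonneg_left
      (mgf_sum_norm_sq_starProjection_le hV hd hind hinv hx (show -(δ / 2) < 1 / 2 by linarith))
      (Real.exp_pos _).le)
  simp only [Finset.sum_apply, ← Finset.mul_sum] at h
  refine h.trans ?_
  rw [ht, ← hM, Real.rpow_def_of_pos h1δ, ← Real.exp_add, Real.exp_le_exp]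
  have h3 := mul_le_mul_of_nonneg_left (le_log_one_add_cubic hδ.le) (Nat.cast_nonneg (α := ℝ) M)
  have h4 : (M : ℝ) * (δ / (1 + δ) + δ ^ 2 / 2 - 2 * δ ^ 3 / 3) =
      δ * (M / (1 + δ)) + M * δ ^ 2 / 2 - 2 * (M * δ ^ 3) / 3 := by ring
  linarith

lemma one_sub_le_measure_forall_mem_net (hV : ∀ i, Measurable (V i))
    (hd : ∀ i, ∀ᵐ ω ∂μ, Module.finrank ℝ (V i ω) = d i) (hind : iIndepFun V μ)
    (hinv : ∀ i, IsUnitarilyInvariant (μ.map (V i)))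
    {M : ℕ} (hM : M = ∑ i, d i) {δ : ℝ} (hδ : 0 < δ) {c : Finset E} (hc : ∀ x ∈ c, ‖x‖ = 1) :
    1 - 2 * c.card * Real.exp (-(M * δ ^ 2 / 4) + M * δ ^ 3 / 3) ≤
      μ.real {ω | ∀ x ∈ c, M / (1 + δ) ≤ Module.finrank ℝ E * ∑ i, ‖(V i ω).starProjection x‖ ^ 2 ∧
        Module.finrank ℝ E * ∑ i, ‖(V i ω).starProjection x‖ ^ 2 ≤ M * (1 + δ)} := by
  set S : E → Ω → ℝ := fun x ω => Module.finrank ℝ E * ∑ i, ‖(V i ω).starProjection x‖ ^ 2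
  set p := Real.exp (-(M * δ ^ 2 / 4) + M * δ ^ 3 / 3)
  set G := {ω | ∀ x ∈ c, M / (1 + δ) ≤ S x ω ∧ S x ω ≤ M * (1 + δ)}
  -- Covering by a bad set and using subadditivity avoids any measurability of `G`.
  let B : Set Ω := ⋃ x ∈ c, ({ω | S x ω ≤ M / (1 + δ)} ∪ {ω | M * (1 + δ) ≤ S x ω})
  have hcover : Set.univ ⊆ G ∪ B := by
    intro ω _
    by_cases hω : ω ∈ G
    · exact Or.inl hω
    · right
      simp only [G, Set.mem_ofPred_eq, not_forall, not_and_or, not_le] at hω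
      obtain ⟨x, hx, h⟩ := hω
      exact Set.mem_iUnion₂.2 ⟨x, hx, h.imp le_of_lt le_of_lt⟩
  have hB : μ.real B ≤ 2 * c.card * p :=
    calc μ.real B ≤ ∑ x ∈ c, μ.real ({ω | S x ω ≤ M / (1 + δ)} ∪ {ω | M * (1 + δ) ≤ S x ω}) :=
          measureReal_biUnion_finset_le _ _
      _ ≤ ∑ x ∈ c, (p + p) := by
          refine Finset.sum_le_sum fun x hx => (measureReal_union_le _ _).trans (add_le_add ?_ ?_)
          · exact measure_sum_norm_sq_starProjection_le hV hd hind hinv (hc x hx) hM hδ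
          · exact measure_le_sum_norm_sq_starProjection hV hd hind hinv (hc x hx) hM hδ
      _ = 2 * c.card * p := by rw [Finset.sum_const, nsmul_eq_mul]; ring
  have h1 : 1 ≤ μ.real G + μ.real B :=
    calc 1 = μ.real Set.univ := probReal_univ.symm
      _ ≤ μ.real (G ∪ B) := measureReal_mono hcover
      _ ≤ _ := measureReal_union_le _ _
  linarith

end

/-! ### Fusion frames -/

lemma isFusionFrameWithBounds_of_net {N : ℕ} {ι : Type*} [Fintype ι]
    (W : ι → Submodule ℝ (EuclideanSpace ℝ (Fin N))) {M δ : ℝ} (hN : 0 < N) (hM : 0 < M)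
    (hδ : 0 < δ) (hδ1 : δ < 3 / 4) {c : Finset (EuclideanSpace ℝ (Fin N))}
    (hc : ∀ x ∈ c, ‖x‖ = 1)
    (hnet : ∀ x : EuclideanSpace ℝ (Fin N), ‖x‖ = 1 → ∃ y ∈ c, ‖y - x‖ ≤ δ / 2)
    (h : ∀ x ∈ c, M / (1 + δ) ≤ N * ∑ i, ‖(W i).starProjection x‖ ^ 2 ∧
      N * ∑ i, ‖(W i).starProjection x‖ ^ 2 ≤ M * (1 + δ)) :
    IsFusionFrameWithBounds W (fun _ => 1) (M / (N * (1 + δ) ^ 6)) (M * (1 + δ) ^ 6 / N) := by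
  have hN' : (0 : ℝ) < N := by exact_mod_cast hN
  have h1 : 1 ≤ 1 + δ := by linarith
  have hpow : (1 + δ) ^ 3 ≤ (1 + δ) ^ 6 := pow_le_pow_right₀ h1 (by norm_num)
  have hone : 1 ≤ (1 + δ) ^ 6 := one_le_pow₀ h1
  -- The net lemma is applied to the frame operator `∑ P_i`, with mesh `ε = δ / 2`.
  have hb := quadratic_bounds_of_net (α := M / N * (1 / (1 + δ))) (β := M / N * (1 + δ))
    (isSymmetric_sum_starProjection W)
    (fun x => by rw [inner_sum_starProjection]; positivity) hc
    (by positivity) (by linarith) hnet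
    (fun y hy => by
      rw [inner_sum_starProjection]
      have := (h y hy).1
      rw [div_mul_eq_mul_div, div_le_iff₀ hN']
      linarith [mul_one_div M (1 + δ)])
    (fun y hy => by
      rw [inner_sum_starProjection, div_mul_eq_mul_div, le_div_iff₀ hN']
      linarith [(h y hy).2])
  simp only [inner_sum_starProjection] at hb
  refine ⟨fun _ => one_pos, by positivity, ?_, fun x => ?_, fun x => ?_⟩
  · calc M / (N * (1 + δ) ^ 6) ≤ M / (N * 1) := by gcongr
      _ = M * 1 / N := by ring
      _ ≤ M * (1 + δ) ^ 6 / N := by gcongr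
  · simp only [one_pow, one_mul]
    refine le_trans ?_ (hb x).1
    gcongr
    calc M / (N * (1 + δ) ^ 6) ≤ M / (N * (1 + δ) ^ 3) := by gcongr
      _ = M / N * (1 / (1 + δ) ^ 3) := by rw [div_mul_div_comm, mul_one]
      _ ≤ M / N * (1 / (1 + δ) - (δ / 2) ^ 2 * ((1 + δ) / (1 - (δ / 2) ^ 2))) := by
        gcongr
        exact le_net_lower_bound hδ hδ1
      _ = _ := by ring
  · simp only [one_pow, one_mul]
    refine (hb x).2.trans (mul_le_mul_of_nonneg_right ?_ (by positivity))
    calc M / N * (1 + δ) / (1 - (δ / 2) ^ 2) = M / N * ((1 + δ) / (1 - (δ / 2) ^ 2)) := by ring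
      _ ≤ M / N * (1 + δ) ^ 6 := by
        gcongr
        exact (net_upper_bound_le hδ hδ1).trans hpow
      _ = _ := by ring

theorem theorem3p5 {Ω : Type*} [MeasurableSpace Ω] (μ : Measure Ω) [IsProbabilityMeasure μ]
    (N K s : ℕ) (d : Fin K → ℕ) (hds : ∀ k, d k ≤ s)
    (V : Fin K → Ω → Submodule ℝ (EuclideanSpace ℝ (Fin N)))
    (hV_meas : ∀ k, Measurable (V k))
    (hV_dim : ∀ k, ∀ᵐ ω ∂μ, Module.finrank ℝ (V k ω) = d k)
    (hV_indep : iIndepFun V μ)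
    (hV_inv : ∀ k, IsUnitarilyInvariant (μ.map (V k)))
    (M : ℕ) (hM : M = ∑ k, d k) (δ : ℝ) (hδ : 0 < δ) :
    1 - 2 * (1 + 4 / δ) ^ N * Real.exp (-(M * δ ^ 2 / 4) + M * δ ^ 3 / 3)
        - 2 * K * (1 + 4 / δ) ^ s * Real.exp (-(N * δ ^ 2 / 4) + N * δ ^ 3 / 3)
      ≤ μ.real {ω |
          IsFusionFrameWithBounds (fun k => V k ω) (fun _ => 1)
            (M / (N * (1 + δ) ^ 6)) (M * (1 + δ) ^ 6 / N) ∧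
          IsNearlyTightFusionFrame (fun k => V k ω) (fun _ => 1)
            ((1 + δ) ^ 6 - 1) (M / N)} := by
  have hK : 0 ≤ 2 * K * (1 + 4 / δ) ^ s * Real.exp (-(N * δ ^ 2 / 4) + N * δ ^ 3 / 3) := by
    positivity
  have h1 : 1 ≤ (1 + 4 / δ) ^ N := one_le_pow₀ (by linarith [show 0 < 4 / δ by positivity])
  -- A nonnegative exponent makes the claimed probability bound negative. Otherwise `M > 0` and `δ <
  -- 3 / 4`, the range in which the net constants are valid.
  by_cases htriv : 0 ≤ -(M * δ ^ 2 / 4) + M * δ ^ 3 / 3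
  · have h2 := Real.one_le_exp htriv
    have h3 := one_le_mul_of_one_le_of_one_le h1 h2
    exact le_trans (by linarith) measureReal_nonneg
  have h3 : (M : ℝ) * δ ^ 2 * (4 * δ - 3) < 0 := by linarith [not_le.1 htriv]
  have hM0 : 0 < M := Nat.pos_of_ne_zero fun h => by simp [h] at h3
  have hδ1 : δ < 3 / 4 := by
    have : 4 * δ - 3 < 0 := (pos_iff_neg_of_mul_neg h3).1 (by positivity)
    linarith
  -- If `N = 0`, every subspace has dimension 0, contradicting `M > 0`.
  have hN : 0 < N := by
    refine Nat.pos_of_ne_zero fun h => hM0.ne' (hM.trans (Finset.sum_eq_zero fun k _ => ?_))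
    obtain ⟨ω, hω⟩ := (hV_dim k).exists
    have := Submodule.finrank_le (V k ω)
    rw [hω, finrank_euclideanSpace_fin, h] at this
    omega
  obtain ⟨c, hc, hcard, hnet⟩ :=
    exists_unit_net (E := EuclideanSpace ℝ (Fin N)) (show 0 < δ / 2 by positivity)
  have hmain := one_sub_le_measure_forall_mem_net hV_meas hV_dim hV_indep hV_inv hM hδ hc
  rw [finrank_euclideanSpace_fin] at hcard hmain
  have h4 : 2 / (δ / 2) = 4 / δ := by field_simp; norm_num
  rw [h4] at hcard
  calc _ ≤ 1 - 2 * (1 + 4 / δ) ^ N * Real.exp (-(M * δ ^ 2 / 4) + M * δ ^ 3 / 3) := by linarith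
    _ ≤ 1 - 2 * c.card * Real.exp (-(M * δ ^ 2 / 4) + M * δ ^ 3 / 3) := by gcongr
    _ ≤ _ := hmain
    _ ≤ _ := by
      refine measureReal_mono fun ω hω => ?_
      have hF := isFusionFrameWithBounds_of_net (fun k => V k ω) hN
        (Nat.cast_pos.2 hM0 : (0 : ℝ) < M) hδ hδ1 hc hnet hω
      refine ⟨hF, sub_pos.2 (one_lt_pow₀ (by linarith) (by norm_num)), ?_⟩
      -- With `1 + ε = (1 + δ) ^ 6` the nearly tight bounds are the frame bounds already obtained.
      convert hF using 1
      · rw [add_sub_cancel, one_div_mul_eq_div, div_div]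
      · rw [add_sub_cancel]; ring
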